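/- A modulus of continuity is a concave, strictly increasing function $\omega:[0,\infty)\to[0,\infty)$ with $\omega(0^+)=0$; its inverse $\omega^{-1}$ is defined on the range $[0,\beta)$ of $\omega$. A function $F:\mathbb{R}^n\to\mathbb{R}$ is of class $C^{1,\omega}(\mathbb{R}^n)$ if it is $C^1$ and there is $M\ge 0$ with $|\nabla F(x)-\nabla F(y)|\le M\,\omega(|x-y|)$ for all $x,y\in\mathbb{R}^n$. Put $$M(\nabla F,\mathbb{R}^n)=\sup_{x\neq y}\frac{|\nabla F(x)-\nabla F(y)|}{\omega(|x-y|)},\qquad \|F\|_{1,\omega}=|F(0)|+|\nabla F(0)|+M(\nabla F,\mathbb{R}^n).$$ For $C\subseteq\mathbb{R}^n$, $f:C\to\mathbb{R}$ and $G:C\to\mathbb{R}^n$, let $M_*(f,G,C)\in[0,\infty]$ be the infimum of all $M>0$ such that $$|G(x)-G(y)|\le M\,\omega(|x-y|)\quad\text{and}\quad f(x)-f(y)-\langle G(y),x-y\rangle\ \ge\ |G(x)-G(y)|\;\omega^{-1}\!\left(\tfrac{1}{2M}|G(x)-G(y)|\right)$$ for all $x,y\in C$, with $M_*(f,G,C)=\infty$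 if there is no such $M$ (if $G$ is not constant and $M_*(f,G,C)<\infty$, this infimum is a minimum). **Theorem.** For every $n$ there is a constant $k(n)$, depending only on $n$, such that the following holds for every modulus of continuity $\omega$, every (not necessarily convex) subset $C\subseteq\mathbb{R}^n$ and all mappings $f:C\to\mathbb{R}$, $G:C\to\mathbb{R}^n$. There is a convex function $F\in C^{1,\omega}(\mathbb{R}^n)$ with $F=f$ and $\nabla F=G$ on $C$ if and only if $M_*(f,G,C)<\infty$. In this case $F$ can be chosen so that $$M(\nabla F,\mathbb{R}^n)\le k(n)\,M_*(f,G,C)$$ and, if moreover $0\in C$, so that also $$\|F\|_{1,\omega}\le k(n)\bigl(|f(0)|+|G(0)|+M_*(f,G,C)\bigr).$$ -/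

import Mathlib

open scoped ENNReal NNReal Topology

noncomputable section

namespace ConvexExt

/-- A modulus of continuity: a concave, strictly increasing function
`ω : [0, ∞) → [0, ∞)` with `ω(0⁺) = 0`. Only the values of `ω` on `[0, ∞)` matter. -/
structure IsModulus (ω : ℝ → ℝ) : Prop where
  nonneg : ∀ t, 0 ≤ t → 0 ≤ ω t
  concave : ConcaveOn ℝ (Set.Ici 0) ω
  strictMono : StrictMonoOn ω (Set.Ici 0)
  tendsto_zero : Filter.Tendsto ω (𝓝[>] 0) (𝓝 0)

/-- The inverse `ω⁻¹ : [0, β) → [0, ∞)` of a modulus of continuity; for `s` in the range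
`ω([0, ∞)) = [0, β)` this is the unique `t ≥ 0` with `ω t = s`. -/
def modInv (ω : ℝ → ℝ) : ℝ → ℝ := Function.invFunOn ω (Set.Ici 0)

/-- `G` has modulus of continuity `ω`: `|G x - G y| ≤ M ω(|x - y|)` for some `M ≥ 0`. -/
def HasModulus {X E : Type*} [MetricSpace X] [NormedAddCommGroup E]
    (ω : ℝ → ℝ) (G : X → E) : Prop :=
  ∃ M : ℝ, 0 ≤ M ∧ ∀ x y : X, ‖G x - G y‖ ≤ M * ω (dist x y)

/-- `M(G, X) = sup_{x ≠ y} |G x - G y| / ω(|x - y|)`, with values in `[0, ∞]`. -/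
def modConst {X E : Type*} [MetricSpace X] [NormedAddCommGroup E]
    (ω : ℝ → ℝ) (G : X → E) : ℝ≥0∞ :=
  ⨆ (x : X) (y : X) (_ : x ≠ y), ENNReal.ofReal (‖G x - G y‖ / ω (dist x y))

/-- `F` is of class `C^{1,ω}(ℝⁿ)`: it is `C¹` and its gradient has modulus of continuity `ω`. -/
def IsC1Omega {n : ℕ} (ω : ℝ → ℝ) (F : EuclideanSpace ℝ (Fin n) → ℝ) : Prop :=
  ContDiff ℝ 1 F ∧ HasModulus ω (gradient F)

/-- `‖F‖_{1,ω} = |F(0)| + |∇F(0)| + M(∇F, ℝⁿ)`. -/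
def normC1Omega {n : ℕ} (ω : ℝ → ℝ) (F : EuclideanSpace ℝ (Fin n) → ℝ) : ℝ≥0∞ :=
  ENNReal.ofReal |F 0| + ENNReal.ofReal ‖gradient F 0‖ + modConst ω (gradient F)

/-- `F` is a convex extension of class `C^{1,ω}` to all of `ℝⁿ` of the jet `(f, G)` on `C`. -/
structure IsConvexExtension {n : ℕ} (ω : ℝ → ℝ) {C : Set (EuclideanSpace ℝ (Fin n))}
    (f : C → ℝ) (G : C → EuclideanSpace ℝ (Fin n))
    (F : EuclideanSpace ℝ (Fin n) → ℝ) : Prop where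
  convex : ConvexOn ℝ Set.univ F
  c1omega : IsC1Omega ω F
  eq_on : ∀ x : C, F x = f x
  gradient_eq_on : ∀ x : C, gradient F x = G x

/-- The constants `M > 0` with `|G x - G y| ≤ M ω(|x - y|)` and
`f x - f y - ⟨G y, x - y⟩ ≥ |G x - G y| ω⁻¹(|G x - G y| / (2M))` on `C`. By the first inequality
the argument of `ω⁻¹` lies in the range of `ω`. -/
def IsAdmissible {n : ℕ} (ω : ℝ → ℝ) {C : Set (EuclideanSpace ℝ (Fin n))}
    (f : C → ℝ) (G : C → EuclideanSpace ℝ (Fin n)) (M : ℝ) : Prop :=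
  0 < M ∧ ∀ x y : C,
    ‖G x - G y‖ ≤ M * ω (dist x y) ∧
    ‖G x - G y‖ * modInv ω (1 / (2 * M) * ‖G x - G y‖) ≤
      f x - f y - inner ℝ (G y) ((x : EuclideanSpace ℝ (Fin n)) - y)

/-- `M_*(f, G, C)`, the smallest admissible constant (`∞` if there is none). For nonconstant `G`
the infimum is attained; for constant `G` it is `0` or `∞`. -/
def Mstar {n : ℕ} (ω : ℝ → ℝ) {C : Set (EuclideanSpace ℝ (Fin n))}
    (f : C → ℝ) (G : C → EuclideanSpace ℝ (Fin n)) : ℝ≥0∞ :=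
  ⨅ (M : ℝ) (_ : IsAdmissible ω f G M), ENNReal.ofReal M

end ConvexExt

end

namespace ConvexExt

open Set Filter

/-! ### Moduli of continuity and their primitives. -/

section Modulus

variable {ω : ℝ → ℝ}

/-! Let φ be the primitive of ω. Young's inequality for φ turns admissibility of M into: every
prescribed tangent plane lies below every function f y + ⟨G y, x - y⟩ + 2Mφ(|x - y|)
(`IsAdmissible.tangent_le`). The infimum of these functions has second differences at most
4M|v|ω(|v|), by `IsModulus.primitive_second_difference`. Its convex envelope F keeps that bound and
is squeezed onto the jet on C. For a convex function, such a bound gives differentiability and the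
modulus 16Mω for the gradient (`exists_gradient_of_second_difference`).

Conversely, two gradient inequalities through a well-chosen third point give admissibility
(`IsConvexExtension.exists_isAdmissible`). Choosing M < 2M_* when 0 < M_* < ∞ gives the
dimension-free constant 32; if M_* = 0 the jet is affine. -/

lemma IsModulus.map_zero (h : IsModulus ω) : ω 0 = 0 := by
  refine le_antisymm (ge_of_tendsto h.tendsto_zero ?_) (h.nonneg 0 le_rfl)
  filter_upwards [self_mem_nhdsWithin] with t ht
  exact (h.strictMono self_mem_Ici (mem_Ici.2 (le_of_lt ht)) ht).le

lemma IsModulus.pos (h : IsModulus ω) {t : ℝ} (ht : 0 < t) : 0 < ω t := by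
  simpa [h.map_zero] using h.strictMono self_mem_Ici ht.le ht

lemma IsModulus.mono (h : IsModulus ω) {s t : ℝ} (hs : 0 ≤ s) (hst : s ≤ t) : ω s ≤ ω t :=
  h.strictMono.monotoneOn hs (hs.trans hst) hst

lemma IsModulus.continuousOn (h : IsModulus ω) : ContinuousOn ω (Ici 0) := by
  refine h.concave.continuousOn_Ici ?_
  rw [← continuousWithinAt_Ioi_iff_Ici, ContinuousWithinAt, h.map_zero]
  exact h.tendsto_zero

lemma IsModulus.tendsto_nhdsGE (h : IsModulus ω) : Tendsto ω (𝓝[≥] 0) (𝓝 0) := by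
  have := h.continuousOn 0 self_mem_Ici
  rwa [ContinuousWithinAt, h.map_zero] at this

/-- `ω t / t` is nonincreasing. -/
lemma IsModulus.mul_le_mul (h : IsModulus ω) {s t : ℝ} (hs : 0 ≤ s) (hst : s ≤ t) :
    s * ω t ≤ t * ω s := by
  rcases hs.eq_or_lt with rfl | hs0
  · simp [h.map_zero]
  have ht : 0 < t := hs0.trans_le hst
  have hc := h.concave.2 (x := 0) (y := t) self_mem_Ici ht.le
    (sub_nonneg.2 ((div_le_one ht).2 hst)) (by positivity : (0 : ℝ) ≤ s / t) (by ring)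
  have e : s / t * t = s := by field_simp
  simp only [smul_eq_mul, mul_zero, zero_add, h.map_zero, e] at hc
  calc s * ω t = t * (s / t * ω t) := by field_simp
    _ ≤ t * ω s := by gcongr

lemma IsModulus.two_mul_le (h : IsModulus ω) {t : ℝ} (ht : 0 ≤ t) : ω (2 * t) ≤ 2 * ω t := by
  rcases ht.eq_or_lt with rfl | ht
  · simp [h.map_zero]
  have := h.mul_le_mul ht.le (by linarith : t ≤ 2 * t)
  exact le_of_mul_le_mul_left (by linarith) ht

lemma IsModulus.modInv_spec (h : IsModulus ω) {s r : ℝ} (hs : 0 ≤ s) (hr : 0 ≤ r)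
    (hsr : s ≤ ω r) : 0 ≤ modInv ω s ∧ ω (modInv ω s) = s := by
  have hex : ∃ t ∈ Ici (0 : ℝ), ω t = s := by
    obtain ⟨t, ht, hts⟩ := intermediate_value_Icc hr
      (h.continuousOn.mono Icc_subset_Ici_self) ⟨h.map_zero.trans_le hs, hsr⟩
    exact ⟨t, ht.1, hts⟩
  exact ⟨Function.invFunOn_mem hex, Function.invFunOn_eq hex⟩

/-- The primitive of a modulus of continuity vanishing at `0`. -/
noncomputable def primitive (ω : ℝ → ℝ) (t : ℝ) : ℝ := ∫ s in (0 : ℝ)..t, ω s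

lemma IsModulus.intervalIntegrable (h : IsModulus ω) {s t : ℝ} (hs : 0 ≤ s) (ht : 0 ≤ t) :
    IntervalIntegrable ω MeasureTheory.volume s t :=
  (h.continuousOn.mono fun _ hx => (le_min hs ht).trans hx.1).intervalIntegrable

lemma IsModulus.primitive_sub (h : IsModulus ω) {s t : ℝ} (hs : 0 ≤ s) (ht : 0 ≤ t) :
    primitive ω t - primitive ω s = ∫ u in s..t, ω u :=
  intervalIntegral.integral_interval_sub_left
    (h.intervalIntegrable le_rfl ht) (h.intervalIntegrable le_rfl hs)

lemma primitive_zero : primitive ω 0 = 0 := intervalIntegral.integral_same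

lemma IsModulus.primitive_tangent_le (h : IsModulus ω) {s t : ℝ} (hs : 0 ≤ s) (ht : 0 ≤ t) :
    primitive ω s + ω s * (t - s) ≤ primitive ω t := by
  suffices ω s * (t - s) ≤ ∫ u in s..t, ω u by
    rw [← h.primitive_sub hs ht] at this; linarith
  have hc : ∀ a b : ℝ, ∫ _ in a..b, ω s = (b - a) * ω s := by simp
  rcases le_total s t with hst | hst
  · have := intervalIntegral.integral_mono_on hst intervalIntegrable_const
      (h.intervalIntegrable hs ht) fun u hu => h.mono hs hu.1
    rw [hc] at this
    linarith
  · have := intervalIntegral.integral_mono_on hst (h.intervalIntegrable ht hs)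
      intervalIntegrable_const fun u hu => h.mono (ht.trans hu.1) hu.2
    rw [hc] at this
    rw [intervalIntegral.integral_symm]
    linarith

lemma IsModulus.primitive_nonneg (h : IsModulus ω) {t : ℝ} (ht : 0 ≤ t) : 0 ≤ primitive ω t := by
  simpa [primitive_zero, h.map_zero] using h.primitive_tangent_le le_rfl ht

/-- The primitive is concave as a function of `t ^ 2`: it lies below its tangent parabolas. -/
lemma IsModulus.primitive_le_parabola (h : IsModulus ω) {s t : ℝ} (hs : 0 < s) (ht : 0 ≤ t) :
    primitive ω t ≤ primitive ω s + ω s / (2 * s) * (t ^ 2 - s ^ 2) := by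
  suffices ∫ u in s..t, ω u ≤ ω s / (2 * s) * (t ^ 2 - s ^ 2) by
    rw [← h.primitive_sub hs.le ht] at this; linarith
  have hc : ∀ a b : ℝ, ∫ u in a..b, ω s / s * u = ω s / (2 * s) * (b ^ 2 - a ^ 2) := by
    intro a b
    rw [intervalIntegral.integral_const_mul, integral_id]
    field_simp
  have hi : ∀ a b : ℝ, IntervalIntegrable (fun u => ω s / s * u) MeasureTheory.volume a b :=
    fun a b => (by fun_prop : Continuous fun u : ℝ => ω s / s * u).intervalIntegrable a b
  rcases le_total s t with hst | hst
  · rw [← hc]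
    refine intervalIntegral.integral_mono_on hst (h.intervalIntegrable hs.le ht) (hi _ _)
      fun u hu => ?_
    rw [div_mul_eq_mul_div, le_div_iff₀ hs]
    linarith [h.mul_le_mul hs.le hu.1]
  · have := intervalIntegral.integral_mono_on hst (hi _ _) (h.intervalIntegrable ht hs.le)
      fun u hu => by
        rw [div_mul_eq_mul_div, div_le_iff₀ hs]
        linarith [h.mul_le_mul (ht.trans hu.1) hu.2]
    rw [hc] at this
    rw [intervalIntegral.integral_symm]
    linarith

variable {E : Type*} [NormedAddCommGroup E] [InnerProductSpace ℝ E]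

/-- Since φ is concave in t², the parallelogram law bounds the left side by 2φ(s) with s² = |w|² +
|v|². The tangent line at s then controls φ(s) - φ(|w|). -/
lemma IsModulus.primitive_second_difference (h : IsModulus ω) (w v : E) :
    primitive ω ‖w + v‖ + primitive ω ‖w - v‖ ≤
      2 * primitive ω ‖w‖ + 2 * (‖v‖ * ω ‖v‖) := by
  rcases eq_or_ne v 0 with rfl | hv
  · simp [h.map_zero, two_mul]
  have hb : 0 < ‖v‖ := norm_pos_iff.2 hv
  have ha := norm_nonneg w
  set s := √(‖w‖ ^ 2 + ‖v‖ ^ 2) with hs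
  have hs2 : s ^ 2 = ‖w‖ ^ 2 + ‖v‖ ^ 2 := Real.sq_sqrt (by positivity)
  have hs0 : 0 < s := Real.sqrt_pos.2 (by positivity)
  have hbs : ‖v‖ ≤ s := Real.le_sqrt_of_sq_le (by nlinarith)
  have hp := h.primitive_le_parabola hs0 (norm_nonneg (w + v))
  have hq := h.primitive_le_parabola hs0 (norm_nonneg (w - v))
  have hpar : ‖w + v‖ ^ 2 + ‖w - v‖ ^ 2 = 2 * s ^ 2 := by
    rw [hs2]; linarith [parallelogram_law_with_norm ℝ w v]
  have hsum : primitive ω ‖w + v‖ + primitive ω ‖w - v‖ ≤ 2 * primitive ω s := by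
    have : ω s / (2 * s) * (‖w + v‖ ^ 2 - s ^ 2) + ω s / (2 * s) * (‖w - v‖ ^ 2 - s ^ 2) = 0 := by
      rw [← mul_add]; apply mul_eq_zero_of_right; linarith
    linarith
  have htan := h.primitive_tangent_le hs0.le ha
  have has : ‖w‖ ≤ s := Real.le_sqrt_of_sq_le (by nlinarith)
  -- Here s - |w| = |v|²/(s + |w|) and ω(s)/s ≤ ω(|v|)/|v|.
  have hstep : ω s * (s - ‖w‖) ≤ ‖v‖ * ω ‖v‖ := by
    have h1 := h.mul_le_mul hb.le hbs
    have hωv := h.nonneg _ hb.le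
    refine le_of_mul_le_mul_left ?_ (mul_pos hb (add_pos_of_pos_of_nonneg hs0 ha))
    calc ‖v‖ * (s + ‖w‖) * (ω s * (s - ‖w‖)) = ‖v‖ * ω s * (s ^ 2 - ‖w‖ ^ 2) := by ring
      _ = ‖v‖ * ω s * ‖v‖ ^ 2 := by rw [hs2]; ring
      _ ≤ s * ω ‖v‖ * ‖v‖ ^ 2 := by gcongr
      _ ≤ (s + ‖w‖) * ω ‖v‖ * ‖v‖ ^ 2 := by gcongr; linarith
      _ = _ := by ring
  linarith

end Modulus

/-! ### Subgradients and differentiability of convex functions. -/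

section Convex

variable {E : Type*} [NormedAddCommGroup E] [InnerProductSpace ℝ E] [FiniteDimensional ℝ E]
  {F : E → ℝ}

/-- Separate (x, F x) from the open strict epigraph; the hyperplane is not vertical because (x, F x
+ 1) lies in the epigraph. -/
lemma exists_subgradient (hF : ConvexOn ℝ univ F) (x : E) :
    ∃ p : E, ∀ z, F x + inner ℝ p (z - x) ≤ F z := by
  have hcont : Continuous F := hF.locallyLipschitz.continuous
  have hopen : IsOpen {q : E × ℝ | q.1 ∈ (univ : Set E) ∧ F q.1 < q.2} := by
    simp only [mem_univ, true_and]
    exact isOpen_lt (by fun_prop) continuous_snd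
  obtain ⟨l, hl⟩ := geometric_hahn_banach_point_open (x := (x, F x)) hF.convex_strict_epigraph
    hopen (by simp)
  have hsplit : ∀ z s, l (z, s) = l (z, 0) + s * l (0, 1) := by
    intro z s
    have : ((z, s) : E × ℝ) = (z, 0) + s • (0, 1) := by simp
    rw [this, map_add, map_smul, smul_eq_mul]
  have hc : 0 < l (0, 1) := by
    have := hl (x, F x + 1) ⟨mem_univ _, by simp⟩
    rw [hsplit x (F x), hsplit x (F x + 1)] at this
    linarith
  have hle : ∀ z, l (x, 0) + F x * l (0, 1) ≤ l (z, 0) + F z * l (0, 1) := by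
    intro z
    refine le_of_forall_pos_lt_add fun ε hε => ?_
    have := hl (z, F z + ε / l (0, 1)) ⟨mem_univ _, by simp; positivity⟩
    rw [hsplit x (F x), hsplit z (F z + _), add_mul, div_mul_cancel₀ _ hc.ne'] at this
    linarith
  refine ⟨(InnerProductSpace.toDual ℝ E).symm
    (-(l (0, 1))⁻¹ • l.comp (ContinuousLinearMap.inl ℝ E ℝ)), fun z => ?_⟩
  rw [InnerProductSpace.toDual_symm_apply]
  have hz := hle z
  have hsub : l (z - x, 0) = l (z, 0) - l (x, 0) := by
    rw [← map_sub]; simp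
  simp only [smul_apply, ContinuousLinearMap.comp_apply, ContinuousLinearMap.inl_apply, hsub,
    smul_eq_mul]
  refine le_of_mul_le_mul_right ?_ hc
  have : (F x + -(l (0, 1))⁻¹ * (l (z, 0) - l (x, 0))) * l (0, 1) =
      F x * l (0, 1) - (l (z, 0) - l (x, 0)) := by field_simp; ring
  rw [this]
  linarith

lemma eq_of_hasGradientAt_of_subgradient {x p q : E} (hq : HasGradientAt F q x)
    (hp : ∀ z, F x + inner ℝ p (z - x) ≤ F z) : q = p := by
  have hmin : IsLocalMin (fun z => F z - innerSL ℝ p z) x := by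
    refine Filter.Eventually.of_forall fun z => ?_
    have := hp z
    rw [inner_sub_right] at this
    simp only [innerSL_apply_apply]
    linarith
  have hd := hmin.hasFDerivAt_eq_zero (hq.hasFDerivAt.sub (innerSL ℝ p).hasFDerivAt)
  refine ext_inner_right ℝ fun v => ?_
  have := congrArg (fun L => L v) hd
  simpa [sub_eq_zero] using this

lemma gradient_inequality (hF : ConvexOn ℝ univ F) {y : E} (hd : DifferentiableAt ℝ F y) (z : E) :
    F y + inner ℝ (gradient F y) (z - y) ≤ F z := by
  obtain ⟨p, hp⟩ := exists_subgradient hF y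
  rw [eq_of_hasGradientAt_of_subgradient hd.hasGradientAt hp]
  exact hp z

variable {ω : ℝ → ℝ} {K : ℝ}

/-- A convex function whose second differences are controlled by `K ‖v‖ ω ‖v‖` is differentiable,
and its gradient has modulus of continuity `4 K ω`. -/
lemma exists_gradient_of_second_difference (hω : IsModulus ω) (hF : ConvexOn ℝ univ F)
    (hK : 0 ≤ K) (h2 : ∀ x v, F (x + v) + F (x - v) ≤ 2 * F x + K * (‖v‖ * ω ‖v‖)) :
    (∀ x, HasGradientAt F (gradient F x) x) ∧
      ∀ x y, ‖gradient F x - gradient F y‖ ≤ 4 * K * ω (dist x y) := by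
  choose p hp using exists_subgradient hF
  have hup : ∀ x v, F (x + v) ≤ F x + inner ℝ (p x) v + K * (‖v‖ * ω ‖v‖) := by
    intro x v
    have h1 := hp x (x - v)
    rw [sub_sub_cancel_left, inner_neg_right] at h1
    linarith [h2 x v]
  have hlow : ∀ x v, F x + inner ℝ (p x) v ≤ F (x + v) := by
    intro x v
    simpa using hp x (x + v)
  have hgrad : ∀ x, HasGradientAt F (p x) x := by
    intro x
    rw [hasGradientAt_iff_isLittleO_nhds_zero]
    have hlim : Tendsto (fun v : E => K * ω ‖v‖) (𝓝 0) (𝓝 0) := by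
      have hn : Tendsto (fun v : E => ‖v‖) (𝓝 0) (𝓝[≥] 0) :=
        tendsto_nhdsWithin_iff.2 ⟨tendsto_norm_zero, Eventually.of_forall fun v => norm_nonneg v⟩
      simpa using (hω.tendsto_nhdsGE.comp hn).const_mul K
    refine Asymptotics.isLittleO_iff.2 fun c hc => ?_
    filter_upwards [hlim.eventually (eventually_le_nhds hc)] with v hv
    have h1 := hup x v
    have h3 := hlow x v
    rw [Real.norm_eq_abs, abs_of_nonneg (by linarith)]
    have := mul_le_mul_of_nonneg_right hv (norm_nonneg v)
    linarith
  have hg : gradient F = p := gradient_eq hgrad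
  refine ⟨fun x => hg ▸ hgrad x, fun x y => ?_⟩
  rw [hg, norm_sub_rev, dist_comm]
  set r := dist y x with hr
  have hr0 : 0 ≤ r := dist_nonneg
  set d := p y - p x with hd
  rcases eq_or_ne d 0 with h0 | h0
  · rw [h0, norm_zero]
    have := hω.nonneg r hr0
    positivity
  have hdn : 0 < ‖d‖ := norm_pos_iff.2 h0
  have hrpos : 0 < r := dist_pos.2 fun e => h0 (by rw [hd, e, sub_self])
  -- Bound F (y + v) above from x and below from y. The displacement from x has length at most 2r,
  -- and ω(2r) ≤ 2ω(r), whence the factor 4.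
  set v := (r / ‖d‖) • d with hv
  have hvn : ‖v‖ = r := by
    rw [hv, norm_smul, Real.norm_of_nonneg (by positivity)]; field_simp
  have hwn : ‖y - x + v‖ ≤ 2 * r := by
    have := norm_add_le (y - x) v
    rw [← dist_eq_norm, hvn] at this
    linarith
  have h1 := hup x (y - x + v)
  rw [show x + (y - x + v) = y + v by abel, inner_add_right] at h1
  have h3 := hlow y v
  have h4 := hp x y
  have hin : inner ℝ d v = r * ‖d‖ := by
    rw [hv, inner_smul_right, real_inner_self_eq_norm_sq]; field_simp
  have hin2 : inner ℝ d v = inner ℝ (p y) v - inner ℝ (p x) v := by rw [hd, inner_sub_left]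
  have h5 : ‖y - x + v‖ * ω ‖y - x + v‖ ≤ 2 * r * (2 * ω r) :=
    mul_le_mul hwn ((hω.mono (norm_nonneg _) hwn).trans (hω.two_mul_le hr0))
      (hω.nonneg _ (norm_nonneg _)) (by linarith)
  have h6 := mul_le_mul_of_nonneg_left h5 hK
  refine le_of_mul_le_mul_left ?_ hrpos
  linarith

end Convex

/-! ### Convex envelopes. -/

section Envelope

variable {E : Type*} [NormedAddCommGroup E] [NormedSpace ℝ E] {g h : E → ℝ}

/-- The largest convex function below `g`. -/
noncomputable def convexEnvelope (g : E → ℝ) (x : E) : ℝ :=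
  ⨆ h : {h : E → ℝ // ConvexOn ℝ univ h ∧ ∀ z, h z ≤ g z}, h.1 x

lemma le_convexEnvelope (hc : ConvexOn ℝ univ h) (hg : ∀ z, h z ≤ g z) (x : E) :
    h x ≤ convexEnvelope g x :=
  le_ciSup (f := fun k : {h : E → ℝ // ConvexOn ℝ univ h ∧ ∀ z, h z ≤ g z} => k.1 x)
    ⟨g x, by rintro _ ⟨k, rfl⟩; exact k.2.2 x⟩ ⟨h, hc, hg⟩

lemma convexEnvelope_le_of_forall (hc : ConvexOn ℝ univ h) (hg : ∀ z, h z ≤ g z) {x : E} {a : ℝ}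
    (ha : ∀ k : E → ℝ, ConvexOn ℝ univ k → (∀ z, k z ≤ g z) → k x ≤ a) :
    convexEnvelope g x ≤ a := by
  have : Nonempty {h : E → ℝ // ConvexOn ℝ univ h ∧ ∀ z, h z ≤ g z} := ⟨⟨h, hc, hg⟩⟩
  exact ciSup_le fun k => ha k.1 k.2.1 k.2.2

lemma convexEnvelope_le (hc : ConvexOn ℝ univ h) (hg : ∀ z, h z ≤ g z) (x : E) :
    convexEnvelope g x ≤ g x :=
  convexEnvelope_le_of_forall hc hg fun _ _ hk => hk x

lemma convexOn_convexEnvelope (hc : ConvexOn ℝ univ h) (hg : ∀ z, h z ≤ g z) :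
    ConvexOn ℝ univ (convexEnvelope g) := by
  refine ⟨convex_univ, fun x _ y _ a b ha hb hab => ?_⟩
  refine convexEnvelope_le_of_forall hc hg fun k hk hkg => ?_
  refine (hk.2 (mem_univ x) (mem_univ y) ha hb hab).trans ?_
  exact add_le_add (smul_le_smul_of_nonneg_left (le_convexEnvelope hk hkg x) ha)
    (smul_le_smul_of_nonneg_left (le_convexEnvelope hk hkg y) hb)

/-- Upper bounds on second differences pass to the convex envelope. -/
lemma convexEnvelope_second_difference (hc : ConvexOn ℝ univ h) (hg : ∀ z, h z ≤ g z) {v : E}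
    {c : ℝ} (h2 : ∀ x, g (x + v) + g (x - v) ≤ 2 * g x + c) (x : E) :
    convexEnvelope g (x + v) + convexEnvelope g (x - v) ≤ 2 * convexEnvelope g x + c := by
  have hF := convexOn_convexEnvelope hc hg
  have htr : ∀ w : E, ConvexOn ℝ univ fun z => convexEnvelope g (z + w) := fun w => by
    simpa [Function.comp_def] using hF.translate_left w
  -- The average of the two translates, lowered by c/2, is itself a convex minorant of g.
  have hH : ConvexOn ℝ univ fun z =>
      (1 / 2 : ℝ) • (convexEnvelope g (z + v) + convexEnvelope g (z + -v)) + -(c / 2) :=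
    (((htr v).add (htr (-v))).smul (by norm_num)).add_const _
  have := le_convexEnvelope (g := g) hH (fun z => ?_) x
  · simp only [smul_eq_mul, ← sub_eq_add_neg] at this
    linarith
  · have h3 := h2 z
    have h4 := convexEnvelope_le hc hg (z + v)
    have h5 := convexEnvelope_le hc hg (z - v)
    simp only [smul_eq_mul, ← sub_eq_add_neg]
    linarith

end Envelope

/-! ### Construction of the extension, and necessity of the condition. -/

section Extension

variable {n : ℕ} {ω : ℝ → ℝ} {C : Set (EuclideanSpace ℝ (Fin n))} {f : C → ℝ}
  {G : C → EuclideanSpace ℝ (Fin n)} {M : ℝ}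

/-- Every prescribed tangent plane lies below every paraboloid-like upper bound. -/
lemma IsAdmissible.tangent_le (hω : IsModulus ω) (hM : IsAdmissible ω f G M) (y z : C)
    (x : EuclideanSpace ℝ (Fin n)) :
    f z + inner ℝ (G z) (x - z) ≤
      f y + inner ℝ (G y) (x - y) + 2 * M * primitive ω ‖x - y‖ := by
  obtain ⟨hM0, h⟩ := hM
  obtain ⟨h1, h2⟩ := h y z
  set d := ‖G y - G z‖ with hd
  have hd0 : 0 ≤ d := norm_nonneg _
  have hle : 1 / (2 * M) * d ≤ ω (dist y z) := by
    rw [one_div_mul_eq_div, div_le_iff₀ (by positivity)]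
    have := mul_nonneg hM0.le (hω.nonneg (dist y z) dist_nonneg)
    linarith
  obtain ⟨ht0, ht⟩ := hω.modInv_spec (by positivity) dist_nonneg hle
  set t := modInv ω (1 / (2 * M) * d)
  -- Young's inequality: the slope 2Mω(t) equals d, so the tangent at t costs only d·t, which the
  -- admissibility inequality pays for.
  have htan := hω.primitive_tangent_le ht0 (norm_nonneg (x - y))
  have hnn := hω.primitive_nonneg ht0
  have hd' : 2 * M * ω t = d := by rw [ht]; field_simp
  have hmul : d * (‖x - y‖ - t) ≤ 2 * M * primitive ω ‖x - y‖ := by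
    rw [← hd', mul_assoc]
    gcongr
    linarith
  have hcs : inner ℝ (G z - G y) (x - y) ≤ d * ‖x - y‖ := by
    rw [hd, norm_sub_rev]
    exact real_inner_le_norm _ _
  have hsplit : inner ℝ (G z) (x - z) =
      inner ℝ (G z - G y) (x - y) + inner ℝ (G y) (x - y) + inner ℝ (G z) ((y : _) - (z : _)) := by
    rw [← inner_add_left, sub_add_cancel, ← inner_add_right]
    congr 1
    abel
  linarith

/-- The infimum of the upper bounds `f y + ⟨G y, x - y⟩ + 2 M φ(‖x - y‖)`, `φ' = ω`. -/
noncomputable def upperBound (ω : ℝ → ℝ) (f : C → ℝ) (G : C → EuclideanSpace ℝ (Fin n)) (M : ℝ)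
    (x : EuclideanSpace ℝ (Fin n)) : ℝ :=
  ⨅ y : C, (f y + inner ℝ (G y) (x - y) + 2 * M * primitive ω ‖x - y‖)

lemma IsAdmissible.upperBound_le (hω : IsModulus ω) (hM : IsAdmissible ω f G M) (y : C)
    (x : EuclideanSpace ℝ (Fin n)) :
    upperBound ω f G M x ≤ f y + inner ℝ (G y) (x - y) + 2 * M * primitive ω ‖x - y‖ :=
  ciInf_le ⟨f y + inner ℝ (G y) (x - y),
    by rintro _ ⟨w, rfl⟩; exact hM.tangent_le hω w y x⟩ y

lemma IsAdmissible.le_upperBound (hω : IsModulus ω) (hM : IsAdmissible ω f G M) (z : C)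
    (x : EuclideanSpace ℝ (Fin n)) :
    f z + inner ℝ (G z) (x - z) ≤ upperBound ω f G M x :=
  have : Nonempty C := ⟨z⟩
  le_ciInf fun y => hM.tangent_le hω y z x

lemma IsAdmissible.upperBound_second_difference [Nonempty C] (hω : IsModulus ω)
    (hM : IsAdmissible ω f G M) (v x : EuclideanSpace ℝ (Fin n)) :
    upperBound ω f G M (x + v) + upperBound ω f G M (x - v) ≤
      2 * upperBound ω f G M x + 4 * M * (‖v‖ * ω ‖v‖) := by
  suffices (upperBound ω f G M (x + v) + upperBound ω f G M (x - v) -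
      4 * M * (‖v‖ * ω ‖v‖)) / 2 ≤ upperBound ω f G M x by linarith
  refine le_ciInf fun y => ?_
  have h1 := hM.upperBound_le hω y (x + v)
  have h2 := hM.upperBound_le hω y (x - v)
  have h3 := mul_le_mul_of_nonneg_left (hω.primitive_second_difference (x - y) v)
    (by linarith [hM.1] : 0 ≤ 2 * M)
  rw [show x + v - (y : _) = x - y + v by abel, inner_add_right] at h1
  rw [show x - v - (y : _) = x - y - v by abel, inner_sub_right] at h2
  linarith

lemma convexOn_affine {E : Type*} [NormedAddCommGroup E] [InnerProductSpace ℝ E] (a : ℝ)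
    (p z : E) : ConvexOn ℝ univ fun x => a + inner ℝ p (x - z) := by
  refine ⟨convex_univ, fun x _ y _ s t _ _ hst => le_of_eq ?_⟩
  have : s • x + t • y - z = s • (x - z) + t • (y - z) := by
    rw [smul_sub, smul_sub, sub_add_sub_comm, ← add_smul, hst, one_smul]
  simp only [this, smul_eq_mul]
  rw [inner_add_right, inner_smul_right, inner_smul_right]
  linear_combination (-a) * hst

lemma contDiff_one_of_hasGradientAt {F : EuclideanSpace ℝ (Fin n) → ℝ} {K : ℝ} (hω : IsModulus ω)
    (hg : ∀ x, HasGradientAt F (gradient F x) x)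
    (hK : ∀ x y, ‖gradient F x - gradient F y‖ ≤ K * ω (dist x y)) : ContDiff ℝ 1 F := by
  refine contDiff_one_iff_fderiv.2 ⟨fun x => (hg x).differentiableAt, ?_⟩
  rw [← toDual_comp_gradient]
  refine (InnerProductSpace.toDual ℝ _).continuous.comp (continuous_iff_continuousAt.2 fun x => ?_)
  refine tendsto_iff_norm_sub_tendsto_zero.2 ?_
  have hn : Tendsto (fun y => dist y x) (𝓝 x) (𝓝[≥] 0) :=
    tendsto_nhdsWithin_iff.2 ⟨tendsto_iff_dist_tendsto_zero.1 tendsto_id,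
      Eventually.of_forall fun v => dist_nonneg⟩
  refine squeeze_zero (fun _ => norm_nonneg _) (fun y => hK y x) ?_
  simpa using (hω.tendsto_nhdsGE.comp hn).const_mul K

lemma IsAdmissible.exists_extension [Nonempty C] (hω : IsModulus ω) (hM : IsAdmissible ω f G M) :
    ∃ F, IsConvexExtension ω f G F ∧
      ∀ x y, ‖gradient F x - gradient F y‖ ≤ 16 * M * ω (dist x y) := by
  have hM0 := hM.1
  have hminor : ∀ z : C, ConvexOn ℝ univ (fun x => f z + inner ℝ (G z) (x - z)) ∧
      ∀ x, f z + inner ℝ (G z) (x - z) ≤ upperBound ω f G M x :=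
    fun z => ⟨convexOn_affine _ _ _, hM.le_upperBound hω z⟩
  obtain ⟨z₀⟩ := ‹Nonempty C›
  have : Nonempty C := ⟨z₀⟩
  obtain ⟨hc₀, hle₀⟩ := hminor z₀
  set F := convexEnvelope (upperBound ω f G M) with hF
  have hconv : ConvexOn ℝ univ F := convexOn_convexEnvelope hc₀ hle₀
  have hlow : ∀ (z : C) x, f z + inner ℝ (G z) (x - z) ≤ F x := fun z x =>
    le_convexEnvelope (hminor z).1 (hminor z).2 x
  -- The tangent plane at z and the upper bound based at z agree at z.
  have heq : ∀ z : C, F z = f z := fun z => by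
    refine le_antisymm ((convexEnvelope_le hc₀ hle₀ z).trans ?_) ?_
    · simpa [primitive_zero] using hM.upperBound_le hω z z
    · simpa using hlow z z
  obtain ⟨hg, hmod⟩ := exists_gradient_of_second_difference hω hconv (by positivity : 0 ≤ 4 * M)
    fun x v => convexEnvelope_second_difference hc₀ hle₀
      (hM.upperBound_second_difference hω v) x
  have hmod' : ∀ x y, ‖gradient F x - gradient F y‖ ≤ 16 * M * ω (dist x y) := fun x y =>
    (hmod x y).trans_eq (by ring)
  refine ⟨F, ⟨hconv, ⟨contDiff_one_of_hasGradientAt hω hg hmod', 16 * M, by positivity, hmod'⟩,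
    heq, fun z => eq_of_hasGradientAt_of_subgradient (hg z) fun x => ?_⟩, hmod'⟩
  rw [heq]
  exact hlow z x

/-- The restriction of a convex function of class `C^{1,ω}` satisfies the extension conditions. -/
lemma IsConvexExtension.exists_isAdmissible {F : EuclideanSpace ℝ (Fin n) → ℝ} (hω : IsModulus ω)
    (hF : IsConvexExtension ω f G F) : ∃ M, IsAdmissible ω f G M := by
  obtain ⟨hconv, ⟨hC1, M₀, hM₀, hmod⟩, heq, hgeq⟩ := hF
  have hdiff : Differentiable ℝ F := hC1.differentiable one_ne_zero
  set M := M₀ + 1 with hM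
  have hM0 : 0 < M := by linarith
  have hmod' : ∀ x y, ‖gradient F x - gradient F y‖ ≤ M * ω (dist x y) := fun x y =>
    (hmod x y).trans (mul_le_mul_of_nonneg_right (by linarith) (hω.nonneg _ dist_nonneg))
  -- Doubling M makes Mω(2s) ≤ |e|/2 for s = ω⁻¹(|e|/(4M)).
  refine ⟨2 * M, by positivity, fun x y => ?_⟩
  rw [← hgeq, ← hgeq, ← heq, ← heq]
  have hb := hmod' x y
  have hω0 : 0 ≤ M * ω (dist (x : EuclideanSpace ℝ (Fin n)) y) :=
    mul_nonneg hM0.le (hω.nonneg _ dist_nonneg)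
  refine ⟨hb.trans (by rw [Subtype.dist_eq]; linarith), ?_⟩
  set e := gradient F x - gradient F y with he
  rcases eq_or_ne e 0 with h0 | h0
  · rw [h0, norm_zero, zero_mul]
    linarith [gradient_inequality hconv (hdiff y) x]
  have hd : 0 < ‖e‖ := norm_pos_iff.2 h0
  obtain ⟨hs0, hs⟩ := hω.modInv_spec (s := 1 / (2 * (2 * M)) * ‖e‖) (by positivity) dist_nonneg
    (r := dist (x : EuclideanSpace ℝ (Fin n)) y) (by
      rw [one_div_mul_eq_div, div_le_iff₀ (by positivity)]; linarith)
  set s := modInv ω (1 / (2 * (2 * M)) * ‖e‖)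
  -- Passing through x - v gains ⟨e, v⟩ = 2s|e| and loses at most s|e| to the variation of the
  -- gradient between x - v and x.
  set v := (2 * s / ‖e‖) • e with hv
  have hvn : ‖v‖ = 2 * s := by
    rw [hv, norm_smul, Real.norm_of_nonneg (by positivity)]; field_simp
  have h1 := gradient_inequality hconv (hdiff y) (x - v)
  have h2 := gradient_inequality hconv (hdiff (x - v)) x
  rw [sub_sub_cancel] at h2
  rw [show (x : EuclideanSpace ℝ (Fin n)) - v - y = x - y - v by abel, inner_sub_right] at h1
  have hin : inner ℝ e v = 2 * s * ‖e‖ := by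
    rw [hv, inner_smul_right, real_inner_self_eq_norm_sq]; field_simp
  rw [he, inner_sub_left, ← he] at hin
  have h3 : inner ℝ (gradient F x - gradient F (x - v)) v ≤ s * ‖e‖ := by
    refine (real_inner_le_norm _ _).trans ?_
    have h4 := hmod' x (x - v)
    rw [dist_eq_norm, sub_sub_cancel, hvn] at h4
    have h5 : M * ω (2 * s) ≤ ‖e‖ / 2 :=
      calc M * ω (2 * s) ≤ M * (2 * ω s) := by gcongr; exact hω.two_mul_le hs0
        _ = ‖e‖ / 2 := by rw [hs]; field_simp
    rw [hvn]
    nlinarith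
  rw [inner_sub_left] at h3
  linarith

end Extension

/-! ### From admissible constants to the infimum M_*. -/

section Constants

variable {n : ℕ} {ω : ℝ → ℝ} {C : Set (EuclideanSpace ℝ (Fin n))} {f : C → ℝ}
  {G : C → EuclideanSpace ℝ (Fin n)}

lemma Mstar_lt_top_iff : Mstar ω f G < ∞ ↔ ∃ M, IsAdmissible ω f G M := by
  simp [Mstar, iInf_lt_iff]

lemma modConst_le {X E : Type*} [MetricSpace X] [NormedAddCommGroup E] (hω : IsModulus ω)
    {g : X → E} {K : ℝ} (h : ∀ x y, ‖g x - g y‖ ≤ K * ω (dist x y)) :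
    modConst ω g ≤ ENNReal.ofReal K := by
  refine iSup_le fun x => iSup_le fun y => iSup_le fun hxy => ENNReal.ofReal_le_ofReal ?_
  exact (div_le_iff₀ (hω.pos (dist_pos.2 hxy))).2 (h x y)

lemma exists_isAdmissible_of_Mstar_lt {a : ℝ≥0∞} (h : Mstar ω f G < a) :
    ∃ M, IsAdmissible ω f G M ∧ ENNReal.ofReal M < a := by
  simpa only [Mstar, iInf_lt_iff, exists_prop] using h

lemma isConvexExtension_affine {p z : EuclideanSpace ℝ (Fin n)} {a : ℝ}
    (hf : ∀ x : C, f x = a + inner ℝ p (x - z)) (hG : ∀ x, G x = p) :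
    IsConvexExtension ω f G (fun x => a + inner ℝ p (x - z)) ∧
      modConst ω (gradient fun x => a + inner ℝ p (x - z)) = 0 := by
  have hgrad : gradient (fun x => a + inner ℝ p (x - z)) = fun _ => p := by
    refine gradient_eq fun x => ?_
    rw [hasGradientAt_iff_hasFDerivAt]
    have := (((innerSL ℝ p).hasFDerivAt (x := x - z)).comp x
      ((hasFDerivAt_id x).sub_const z)).const_add a
    convert! this using 1
  refine ⟨⟨convexOn_affine _ _ _,
    ⟨contDiff_const.add (contDiff_const.inner ℝ (contDiff_id.sub contDiff_const)), 0, le_rfl, ?_⟩, fun x => (hf x).symm, ?_⟩, ?_⟩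
  · simp [hgrad]
  · simp [hgrad, hG]
  · simp [hgrad, modConst]

/-- If `M_* = 0`, the jet is affine. -/
lemma exists_extension_of_Mstar_eq_zero (h : Mstar ω f G = 0) :
    ∃ F, IsConvexExtension ω f G F ∧ modConst ω (gradient F) = 0 := by
  rcases isEmpty_or_nonempty C with hC | ⟨⟨z⟩⟩
  · exact ⟨_, isConvexExtension_affine (p := 0) (z := 0) (a := 0) isEmptyElim isEmptyElim⟩
  have hG : ∀ x y : C, G x = G y := by
    intro x y
    rw [← sub_eq_zero, ← norm_le_zero_iff]
    refine le_of_forall_pos_le_add fun ε hε => ?_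
    -- The absolute value and the 1 keep the denominator positive without assuming that ω is a
    -- modulus.
    have hpos : 0 < ε / (|ω (dist x y)| + 1) := by positivity
    obtain ⟨M, hM, hlt⟩ := exists_isAdmissible_of_Mstar_lt (ω := ω) (f := f) (G := G)
      (a := ENNReal.ofReal (ε / (|ω (dist x y)| + 1))) (by rw [h]; simpa using hpos)
    rw [ENNReal.ofReal_lt_ofReal_iff hpos, lt_div_iff₀ (by positivity)] at hlt
    have h1 := (hM.2 x y).1
    have h2 := mul_le_mul_of_nonneg_left (le_abs_self (ω (dist x y))) hM.1.le
    linarith [hM.1]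
  obtain ⟨M, hM⟩ := Mstar_lt_top_iff.1 (h.trans_lt ENNReal.zero_lt_top)
  refine ⟨_, isConvexExtension_affine (p := G z) (z := z) (a := f z) (fun x => ?_) fun x => hG x z⟩
  -- With G constant, the inequalities for (x, z) and (z, x) are opposite, forcing equality.
  have h1 := (hM.2 x z).2
  have h2 := (hM.2 z x).2
  rw [hG x z] at h1 h2
  simp only [sub_self, norm_zero, zero_mul] at h1 h2
  have : inner ℝ (G z) ((z : EuclideanSpace ℝ (Fin n)) - x) =
      - inner ℝ (G z) ((x : EuclideanSpace ℝ (Fin n)) - z) := by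
    rw [← inner_neg_right, neg_sub]
  linarith

lemma exists_extension_of_Mstar_lt_top (hω : IsModulus ω) (h : Mstar ω f G < ∞) :
    ∃ F, IsConvexExtension ω f G F ∧ modConst ω (gradient F) ≤ 32 * Mstar ω f G := by
  rcases eq_or_ne (Mstar ω f G) 0 with h0 | h0
  · obtain ⟨F, hF, hF0⟩ := exists_extension_of_Mstar_eq_zero h0
    exact ⟨F, hF, by simp [hF0]⟩
  -- For empty C every positive constant is admissible, so M_* would be 0.
  have : Nonempty C := by
    by_contra hC
    rw [not_nonempty_iff] at hC
    refine h0 (le_antisymm (ENNReal.le_of_forall_pos_le_add fun ε hε _ => ?_) bot_le)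
    rw [zero_add]
    exact (iInf₂_le (ε : ℝ) ⟨NNReal.coe_pos.2 hε, fun x => isEmptyElim x⟩).trans_eq
      ENNReal.ofReal_coe_nnreal
  have hlt : Mstar ω f G < 2 * Mstar ω f G := by
    simpa [two_mul] using ENNReal.lt_add_right h.ne h0
  obtain ⟨M, hM, hM2⟩ := exists_isAdmissible_of_Mstar_lt hlt
  obtain ⟨F, hF, hmod⟩ := hM.exists_extension hω
  refine ⟨F, hF, (modConst_le hω hmod).trans ?_⟩
  rw [ENNReal.ofReal_mul (by norm_num)]
  calc ENNReal.ofReal 16 * ENNReal.ofReal M ≤ 16 * (2 * Mstar ω f G) := by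
        gcongr
        simp
    _ = 32 * Mstar ω f G := by rw [← mul_assoc]; norm_num

end Constants

end ConvexExt

theorem theorem1p5 (n : ℕ) :
    ∃ k : ℝ≥0, ∀ ω : ℝ → ℝ, ConvexExt.IsModulus ω →
      ∀ (C : Set (EuclideanSpace ℝ (Fin n))) (f : C → ℝ) (G : C → EuclideanSpace ℝ (Fin n)),
        ((∃ F : EuclideanSpace ℝ (Fin n) → ℝ, ConvexExt.IsConvexExtension ω f G F) ↔
          ConvexExt.Mstar ω f G < ∞) ∧
        (ConvexExt.Mstar ω f G < ∞ →
          ∃ F : EuclideanSpace ℝ (Fin n) → ℝ,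
            ConvexExt.IsConvexExtension ω f G F ∧
            ConvexExt.modConst ω (gradient F) ≤ k * ConvexExt.Mstar ω f G ∧
            ∀ h0 : (0 : EuclideanSpace ℝ (Fin n)) ∈ C,
              ConvexExt.normC1Omega ω F ≤
                k * (ENNReal.ofReal |f ⟨0, h0⟩| + ENNReal.ofReal ‖G ⟨0, h0⟩‖ +
                  ConvexExt.Mstar ω f G)) := by
  refine ⟨32, fun ω hω C f G => ⟨⟨?_, fun h => ?_⟩, fun h => ?_⟩⟩
  · rintro ⟨F, hF⟩
    exact ConvexExt.Mstar_lt_top_iff.2 (hF.exists_isAdmissible hω)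
  · obtain ⟨F, hF, -⟩ := ConvexExt.exists_extension_of_Mstar_lt_top hω h
    exact ⟨F, hF⟩
  · obtain ⟨F, hF, hle⟩ := ConvexExt.exists_extension_of_Mstar_lt_top hω h
    refine ⟨F, hF, by simpa using hle, fun h0 => ?_⟩
    have h1 := hF.eq_on ⟨0, h0⟩
    have h2 := hF.gradient_eq_on ⟨0, h0⟩
    simp only at h1 h2
    rw [ConvexExt.normC1Omega, h1, h2, mul_add]
    refine add_le_add (le_mul_of_one_le_left' ?_) (by simpa using hle)
    norm_num
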